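/- Let $\mathcal G$ be a strongly connected directed graph with finite vertex set $\{1,\dots,N\}$ and adjacency matrix $A$ ($a_{ij}=1$ if there is an edge from $j$ to $i$, and $0$ otherwise; self-loops are allowed). Let $d_i^{\mathrm{in}}=\sum_j a_{ij}$ and $d_j^{\mathrm{out}}=\sum_i a_{ij}$ be the in- and out-degrees, let $D_{\mathrm{in}}$ and $D_{\mathrm{out}}$ be the corresponding diagonal matrices, and let $L=D_{\mathrm{in}}^{-1/2}AD_{\mathrm{out}}^{-1/2}\in\mathbb R^{N\times N}$ be the symmetrically normalized adjacency (an isolated single vertex has $L=0$). For a complex matrix $M\in\mathbb C^{n\times n}$ let $\lambda_1(M),\dots,\lambda_n(M)$ be its eigenvalues ordered by increasing real part. For $x\in\mathbb C^{N\times K}$ with rows $x_i$ define the Dirichlet energy $$\mathfrak E(x)=\frac14\sum_{i,j=1}^N a_{ij}\Big\|\frac{x_i}{\sqrt{d_i^{\mathrm{in}}}}-\frac{x_j}{\sqrt{d_j^{\mathrm{out}}}}\Big\|_2^2 .$$ A sequence $(x_n)_{n\ge 0}$ in $\mathbb C^{N\times K}$ is called $\lambda$-frequency-dominant, for a real $\lambda\ge0$,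 if $\mathfrak E(x_n/\|x_n\|_2)\to\lambda/2$ as $n\to\infty$, where $\|\cdot\|_2$ is the Frobenius norm. It is called highest-frequency-dominant (HFD), respectively lowest-frequency-dominant (LFD), if it is $\lambda$-frequency-dominant with $\lambda$ a real eigenvalue of $I-L$ whose real part is the largest, respectively the smallest, among all eigenvalues of $I-L$. Let $W\in\mathbb R^{K\times K}$ be diagonal with smallest eigenvalue $\lambda_1(W)$ and largest eigenvalue $\lambda_K(W)$. Consider the heat equation $x'(t)=-L\,x(t)\,W$, $x(0)=x_0$, and its explicit Euler approximation with step size $h$, that is, $x_{n+1}=x_n-h\,L\,x_n\,W$. Then there is $h_0>0$ (depending only on $\mathcal G$ and $W$) such that for every $h\in(0,h_0)$ the following holds for (Lebesgue-)almost every $x_0\in\mathbb C^{N\times K}$. 1. If $\lambda_1(L)$ is the unique eigenvalue of $L$ with smallest real part and $\lambda_K(W)\,\Re\lambda_1(L)<\lambda_1(W)\,\Re\lambda_N(L)$, then $(x_n)_{n\ge0}$ is HFD. 2. If $\lambda_K(W)\,\Re\lambda_1(L)>\lambda_1(W)\,\Re\lambda_N(L)$, and, in case $\mathcal G$ has self-loops,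 also $\lambda_1(W)<0$ (which is automatic if $\mathcal G$ has no self-loops), then $(x_n)_{n\ge0}$ is LFD. -/

import Mathlib

open Filter Topology MeasureTheory

noncomputable section

namespace GraphHeat

variable {V : Type*} [Fintype V] [DecidableEq V]

/-- Every vertex can be reached from every vertex by a directed path. -/
def StronglyConnected (G : Digraph V) : Prop :=
  ∀ u v : V, Relation.ReflTransGen G.Adj u v

open Classical in
/-- Adjacency matrix: the entry `(i, j)` is `1` if there is an edge from `j` to `i`. -/
def adjacency (G : Digraph V) : Matrix V V ℝ :=
  Matrix.of fun i j => if G.Adj j i then 1 else 0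

/-- The in-degree of `i`, the `i`-th row sum of the adjacency matrix. -/
def inDegree (G : Digraph V) (i : V) : ℝ := ∑ j, adjacency G i j

/-- The out-degree of `j`, the `j`-th column sum of the adjacency matrix. -/
def outDegree (G : Digraph V) (j : V) : ℝ := ∑ i, adjacency G i j

/-- The symmetrically normalized adjacency `D_in^(-1/2) A D_out^(-1/2)`. -/
def sna (G : Digraph V) : Matrix V V ℝ :=
  Matrix.diagonal (fun i => (Real.sqrt (inDegree G i))⁻¹) * adjacency G *
    Matrix.diagonal (fun j => (Real.sqrt (outDegree G j))⁻¹)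

/-- The symmetrically normalized adjacency, as a complex matrix. -/
def snaC (G : Digraph V) : Matrix V V ℂ := (sna G).map Complex.ofReal

/-- `l` is an eigenvalue of `M` whose real part is the smallest (a choice of `λ₁(M)`). -/
def IsLowestEigenvalue (M : Matrix V V ℂ) (l : ℂ) : Prop :=
  l ∈ spectrum ℂ M ∧ ∀ m ∈ spectrum ℂ M, l.re ≤ m.re

/-- `l` is an eigenvalue of `M` whose real part is the largest (a choice of `λ_N(M)`). -/
def IsHighestEigenvalue (M : Matrix V V ℂ) (l : ℂ) : Prop :=
  l ∈ spectrum ℂ M ∧ ∀ m ∈ spectrum ℂ M, m.re ≤ l.re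

variable {K : ℕ}

/-- The Dirichlet energy
`(1/4) ∑ a_{ij} ‖x_i / √(d_i^in) - x_j / √(d_j^out)‖²` of node features with `K` channels. -/
def dirichletEnergy (G : Digraph V) (x : Matrix V (Fin K) ℂ) : ℝ :=
  (1 / 4) * ∑ i, ∑ j, adjacency G i j *
    ∑ k, ‖x i k / (Real.sqrt (inDegree G i) : ℂ) - x j k / (Real.sqrt (outDegree G j) : ℂ)‖ ^ 2

/-- The Frobenius norm of a feature matrix. -/
def frobenius (x : Matrix V (Fin K) ℂ) : ℝ := Real.sqrt (∑ i, ∑ k, ‖x i k‖ ^ 2)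

/-- The feature matrix divided by its Frobenius norm. -/
def normalized (x : Matrix V (Fin K) ℂ) : Matrix V (Fin K) ℂ := (frobenius x)⁻¹ • x

/-- A discrete-time trajectory is `l`-frequency-dominant. -/
def IsFrequencyDominant (G : Digraph V) (x : ℕ → Matrix V (Fin K) ℂ) (l : ℝ) : Prop :=
  0 ≤ l ∧ Tendsto (fun n => dirichletEnergy G (normalized (x n))) atTop (𝓝 (l / 2))

/-- Lowest-frequency-dominant: `l`-frequency-dominant, where the real number `l` is the
eigenvalue of `I - L` with smallest real part. -/
def IsLFD (G : Digraph V) (x : ℕ → Matrix V (Fin K) ℂ) : Prop :=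
  ∃ l : ℝ, IsLowestEigenvalue (1 - snaC G) (l : ℂ) ∧ IsFrequencyDominant G x l

/-- Highest-frequency-dominant: `l`-frequency-dominant, where the real number `l` is the
eigenvalue of `I - L` with largest real part. -/
def IsHFD (G : Digraph V) (x : ℕ → Matrix V (Fin K) ℂ) : Prop :=
  ∃ l : ℝ, IsHighestEigenvalue (1 - snaC G) (l : ℂ) ∧ IsFrequencyDominant G x l

/-- The right-hand side of the graph heat equation `x' = - L x W`. -/
def heatField (G : Digraph V) (W : Matrix (Fin K) (Fin K) ℝ)
    (x : Matrix V (Fin K) ℂ) : Matrix V (Fin K) ℂ :=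
  -(snaC G * x * W.map Complex.ofReal)

/-- The explicit Euler scheme with step size `h` for the autonomous equation `x' = f x`:
`eulerScheme f h x₀ n` approximates the solution at time `n h`. -/
def eulerScheme (f : Matrix V (Fin K) ℂ → Matrix V (Fin K) ℂ) (h : ℝ)
    (x₀ : Matrix V (Fin K) ℂ) : ℕ → Matrix V (Fin K) ℂ
  | 0 => x₀
  | n + 1 => eulerScheme f h x₀ n + h • f (eulerScheme f h x₀ n)

end GraphHeat

end

/-! Since `W` is diagonal, the channels decouple: channel `k` evolves under `1 - h w_k L`, so the
Euler step has eigenvalues `1 - h w_k μ` with `μ` an eigenvalue of `L`. Their modulus is `1 - h w_k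
Re μ` to first order in `h`, so for small `h` the dominant ones minimise `w_k Re μ`
(`eventually_norm_one_sub_lt`).

If this minimum is reached only at one real eigenvalue `l`, then almost every orbit converges in
direction to an eigenvector of the Euler step, even with Jordan blocks
(`exists_submodule_tendsto_of_dominant`). Its nonzero columns are eigenvectors of `L` for `l`, and
such a matrix of Frobenius norm one has energy `(1 - l) / 2` (`dirichletEnergy_of_mul_eq_smul`).

It remains to locate the minimum. By Perron–Frobenius (`exists_mem_spectrum_norm_le_re`) the
spectral radius of `L` is an eigenvalue, hence equals `λ_N(L)`, the only eigenvalue with the largest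
real part. Comparing `λ_K(W) Re λ₁(L)` with `λ₁(W) Re λ_N(L)` then decides between `l = λ₁(L)` (HFD)
and `l = λ_N(L)` (LFD). -/

noncomputable section

namespace GraphHeat

/-! ### Power iteration with a strictly dominant eigenvalue -/

section Dominance

variable {E : Type*} [NormedAddCommGroup E] [NormedSpace ℂ E]

/-- The vectors whose orbit under `T` is of smaller order than `ν ^ n`. -/
def decaySubmodule (T : Module.End ℂ E) (ν : ℂ) : Submodule ℂ E where
  carrier := {x | Tendsto (fun n : ℕ => (ν⁻¹) ^ n • (T ^ n) x) atTop (𝓝 0)}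
  zero_mem' := by simp
  add_mem' := by
    intro x y hx hy
    simpa using Tendsto.add hx hy
  smul_mem' := by
    intro c x hx
    have := Tendsto.const_smul hx c
    simp only [smul_zero] at this
    refine this.congr fun n => ?_
    rw [map_smul, smul_comm]

theorem mem_decaySubmodule {T : Module.End ℂ E} {ν : ℂ} {x : E} :
    x ∈ decaySubmodule T ν ↔ Tendsto (fun n : ℕ => (ν⁻¹) ^ n • (T ^ n) x) atTop (𝓝 0) :=
  Iff.rfl

theorem exists_norm_pow_apply_le {T : Module.End ℂ E} {μ : ℂ} {s : ℝ} (hs : ‖μ‖ < s) (k : ℕ) :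
    ∀ x : E, ((T - μ • (1 : Module.End ℂ E)) ^ k) x = 0 → ∃ C, ∀ n, ‖(T ^ n) x‖ ≤ C * s ^ n := by
  have hs0 : 0 < s := (norm_nonneg _).trans_lt hs
  induction k with
  | zero =>
    intro x hx
    refine ⟨0, fun n => ?_⟩
    have : x = 0 := by simpa using hx
    simp [this]
  | succ k ih =>
    intro x hx
    obtain ⟨C', hC'⟩ := ih ((T - μ • (1 : Module.End ℂ E)) x) (by rwa [pow_succ] at hx)
    have hd : 0 < s - ‖μ‖ := sub_pos.2 hs
    -- The constant `C` must satisfy `‖x‖ ≤ C` for `n = 0` and `‖μ‖ C + C' ≤ s C` for the induction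
    -- step.
    refine ⟨max ‖x‖ (C' / (s - ‖μ‖)), fun n => ?_⟩
    induction n with
    | zero => simp
    | succ n ihn =>
      have hsplit : (T ^ (n + 1)) x =
          μ • (T ^ n) x + (T ^ n) ((T - μ • (1 : Module.End ℂ E)) x) := by
        rw [pow_succ]
        simp
      have hC : C' ≤ max ‖x‖ (C' / (s - ‖μ‖)) * (s - ‖μ‖) := by
        rw [← div_le_iff₀ hd]
        exact le_max_right _ _
      have hsn : 0 < s ^ n := pow_pos hs0 n
      calc ‖(T ^ (n + 1)) x‖
          ≤ ‖μ‖ * ‖(T ^ n) x‖ + ‖(T ^ n) ((T - μ • (1 : Module.End ℂ E)) x)‖ := by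
            rw [hsplit, ← norm_smul]
            exact norm_add_le _ _
        _ ≤ ‖μ‖ * (max ‖x‖ (C' / (s - ‖μ‖)) * s ^ n) +
              max ‖x‖ (C' / (s - ‖μ‖)) * (s - ‖μ‖) * s ^ n := by
            gcongr
            exact (hC' n).trans (by gcongr)
        _ = max ‖x‖ (C' / (s - ‖μ‖)) * s ^ (n + 1) := by ring

/-- A rate `s` strictly between `‖μ‖` and `‖ν‖` absorbs the polynomial growth caused by Jordan
blocks. -/
theorem maxGenEigenspace_le_decaySubmodule {T : Module.End ℂ E} {μ ν : ℂ} (h : ‖μ‖ < ‖ν‖) :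
    T.maxGenEigenspace μ ≤ decaySubmodule T ν := by
  intro x hx
  obtain ⟨k, hk⟩ := (Module.End.mem_maxGenEigenspace _ _ _).1 hx
  obtain ⟨s, hμs, hsν⟩ := exists_between h
  obtain ⟨C, hC⟩ := exists_norm_pow_apply_le hμs k x hk
  have hs0 : 0 < s := (norm_nonneg _).trans_lt hμs
  have hν : 0 < ‖ν‖ := hs0.trans hsν
  rw [mem_decaySubmodule]
  have hlim : Tendsto (fun n : ℕ => C * (s / ‖ν‖) ^ n) atTop (𝓝 0) := by
    simpa using (tendsto_pow_atTop_nhds_zero_of_lt_one (by positivity)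
      ((div_lt_one hν).2 hsν)).const_mul C
  refine squeeze_zero_norm (fun n => ?_) hlim
  rw [norm_smul, norm_pow, norm_inv, div_pow, inv_pow]
  calc (‖ν‖ ^ n)⁻¹ * ‖(T ^ n) x‖ ≤ (‖ν‖ ^ n)⁻¹ * (C * s ^ n) := by
        gcongr
        exact hC n
    _ = C * (s ^ n / ‖ν‖ ^ n) := by ring

theorem maxGenEigenspace_le_decaySubmodule_of_hasEigenvalue {T : Module.End ℂ E} {μ ν : ℂ}
    (h : T.HasEigenvalue μ → ‖μ‖ < ‖ν‖) : T.maxGenEigenspace μ ≤ decaySubmodule T ν := by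
  by_cases hμ : T.HasEigenvalue μ
  · exact maxGenEigenspace_le_decaySubmodule (h hμ)
  · have : T.maxGenEigenspace μ = ⊥ := by
      by_contra hne
      exact hμ (Module.End.hasUnifEigenvalue_iff_hasUnifEigenvalue_one (by simp) |>.1 hne)
    simp [this]

theorem decaySubmodule_eq_top [FiniteDimensional ℂ E] {T : Module.End ℂ E} {ν : ℂ}
    (h : ∀ μ, T.HasEigenvalue μ → ‖μ‖ < ‖ν‖) : decaySubmodule T ν = ⊤ := by
  rw [eq_top_iff, ← Module.End.iSup_maxGenEigenspace_eq_top T]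
  exact iSup_le fun μ => maxGenEigenspace_le_decaySubmodule_of_hasEigenvalue (h μ)

/-- As `n.choose j` grows like `n ^ j / j!`, division by `n ^ m` leaves only the top term of a
binomial expansion. -/
theorem tendsto_choose_mul_inv_pow (j m : ℕ) (hj : j ≤ m) :
    Tendsto (fun n : ℕ => (n.choose j : ℝ) * ((n : ℝ)⁻¹) ^ m) atTop
      (𝓝 (if j = m then (m.factorial : ℝ)⁻¹ else 0)) := by
  have h1 : Tendsto (fun n : ℕ => (n : ℝ) * (n : ℝ)⁻¹) atTop (𝓝 1) := by
    refine tendsto_const_nhds.congr' ?_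
    filter_upwards [eventually_ne_atTop 0] with n hn
    rw [mul_inv_cancel₀ (by exact_mod_cast hn)]
  have h2 := ProbabilityTheory.tendsto_choose_mul_pow_atTop j h1
  have h3 : Tendsto (fun n : ℕ => ((n : ℝ)⁻¹) ^ (m - j)) atTop (𝓝 (0 ^ (m - j))) :=
    (tendsto_inv_atTop_nhds_zero_nat (𝕜 := ℝ)).pow (m - j)
  have h4 := h2.mul h3
  have e : (1 : ℝ) ^ j / j.factorial * 0 ^ (m - j) =
      if j = m then (m.factorial : ℝ)⁻¹ else 0 := by
    split_ifs with hjm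
    · subst hjm
      simp
    · rw [zero_pow (by omega)]
      simp
  rw [e] at h4
  refine h4.congr fun n => ?_
  rw [mul_assoc, ← pow_add, Nat.add_sub_cancel' hj]

/-- On a generalized eigenspace, orbits converge in direction to an eigenvector. -/
theorem exists_tendsto_of_mem_maxGenEigenspace {T : Module.End ℂ E} {ν : ℂ} (hν : ν ≠ 0) {y : E}
    (hy : y ∈ T.maxGenEigenspace ν) (hy0 : y ≠ 0) :
    ∃ (m : ℕ) (u : E), u ≠ 0 ∧ T u = ν • u ∧
      Tendsto (fun n : ℕ => (((n : ℝ)⁻¹) ^ m) • (ν⁻¹) ^ n • (T ^ n) y) atTop (𝓝 u) := by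
  classical
  set N : Module.End ℂ E := T - ν • (1 : Module.End ℂ E) with hN
  have hex : ∃ k : ℕ, (N ^ k) y = 0 := (Module.End.mem_maxGenEigenspace _ _ _).1 hy
  obtain ⟨m, hm⟩ : ∃ m, Nat.find hex = m + 1 := by
    refine Nat.exists_eq_succ_of_ne_zero fun h0 => hy0 ?_
    have := Nat.find_spec hex
    rw [h0] at this
    simpa using this
  have hm1 : (N ^ (m + 1)) y = 0 := hm ▸ Nat.find_spec hex
  have hm0 : (N ^ m) y ≠ 0 := Nat.find_min hex (by omega)
  -- Here `m + 1` is the least power of `N` killing `y`. In `T ^ n y = ∑ j ≤ m, (n.choose j) ν ^ (n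
  -- - j) N ^ j y` the term `j = m` dominates, and `N ^ m y` is an eigenvector.
  refine ⟨m, ((m.factorial : ℝ)⁻¹) • (ν⁻¹) ^ m • (N ^ m) y, ?_, ?_, ?_⟩
  · have : (m.factorial : ℝ)⁻¹ ≠ 0 := by positivity
    exact smul_ne_zero this (smul_ne_zero (pow_ne_zero _ (inv_ne_zero hν)) hm0)
  · have h1 : T ((N ^ m) y) = ν • (N ^ m) y := by
      rw [pow_succ'] at hm1
      simpa [hN, sub_eq_zero] using hm1
    rw [← Complex.coe_smul, map_smul, map_smul, h1]
    simp only [smul_smul]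
    congr 1
    ring
  · have hexp : ∀ n, m ≤ n → (T ^ n) y =
        ∑ j ∈ Finset.range (m + 1), ((n.choose j : ℂ) * ν ^ (n - j)) • (N ^ j) y := by
      intro n hmn
      have hT : T = N + ν • (1 : Module.End ℂ E) := by simp [hN]
      have hc : Commute N (ν • (1 : Module.End ℂ E)) := (Commute.one_right N).smul_right ν
      rw [hT, hc.add_pow, LinearMap.sum_apply]
      have hterm : ∀ j, ((N ^ j * (ν • (1 : Module.End ℂ E)) ^ (n - j) *
          (n.choose j : Module.End ℂ E)) y) = ((n.choose j : ℂ) * ν ^ (n - j)) • (N ^ j) y := by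
        intro j
        rw [smul_pow, one_pow, ← nsmul_one (n.choose j)]
        simp only [Module.End.mul_apply, LinearMap.smul_apply, Module.End.one_apply,
          map_smul, ← Nat.cast_smul_eq_nsmul ℂ, smul_smul]
      rw [Finset.sum_congr rfl fun j _ => hterm j]
      symm
      refine Finset.sum_subset (Finset.range_subset_range.2 (by omega)) fun j _ hj => ?_
      have : m + 1 ≤ j := by simpa using hj
      rw [show j = (j - (m + 1)) + (m + 1) by omega, pow_add, Module.End.mul_apply, hm1]
      simp
    have hsum : Tendsto (fun n : ℕ => ∑ j ∈ Finset.range (m + 1),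
        ((n.choose j : ℝ) * ((n : ℝ)⁻¹) ^ m) • (ν⁻¹) ^ j • (N ^ j) y) atTop
        (𝓝 (∑ j ∈ Finset.range (m + 1),
          (if j = m then (m.factorial : ℝ)⁻¹ else 0) • (ν⁻¹) ^ j • (N ^ j) y)) :=
      tendsto_finsetSum _ fun j hj =>
        (tendsto_choose_mul_inv_pow j m (by simpa [Nat.lt_succ_iff] using hj)).smul_const _
    have hval : ∑ j ∈ Finset.range (m + 1),
        (if j = m then (m.factorial : ℝ)⁻¹ else 0) • (ν⁻¹) ^ j • (N ^ j) y =
        ((m.factorial : ℝ)⁻¹) • (ν⁻¹) ^ m • (N ^ m) y := by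
      simp [ite_smul, Finset.sum_ite_eq']
    rw [hval] at hsum
    refine hsum.congr' ?_
    filter_upwards [eventually_ge_atTop m] with n hn
    rw [hexp n hn, Finset.smul_sum, Finset.smul_sum]
    refine Finset.sum_congr rfl fun j hj => ?_
    have hjn : j ≤ n := by
      have := Finset.mem_range.1 hj
      omega
    simp only [← Complex.coe_smul, smul_smul]
    congr 1
    have hpow : ν⁻¹ ^ n * ν ^ (n - j) = ν⁻¹ ^ j := by
      obtain ⟨d, rfl⟩ := Nat.exists_eq_add_of_le hjn
      rw [Nat.add_sub_cancel_left, pow_add, mul_assoc, ← mul_pow, inv_mul_cancel₀ hν]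
      simp
    rw [← hpow]
    push_cast
    ring

/-- If `ν` strictly dominates all other eigenvalues, then outside a proper subspace the orbits of
`T`, suitably rescaled, converge to an eigenvector for `ν`. -/
theorem exists_submodule_tendsto_of_dominant [FiniteDimensional ℂ E] {T : Module.End ℂ E} {ν : ℂ}
    (hν0 : ν ≠ 0) (hν : T.HasEigenvalue ν)
    (hdom : ∀ μ, T.HasEigenvalue μ → μ ≠ ν → ‖μ‖ < ‖ν‖) :
    ∃ F : Submodule ℂ E, F ≠ ⊤ ∧ ∀ x, x ∉ F → ∃ (m : ℕ) (u : E), u ≠ 0 ∧ T u = ν • u ∧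
      Tendsto (fun n : ℕ => (((n : ℝ)⁻¹) ^ m) • (ν⁻¹) ^ n • (T ^ n) x) atTop (𝓝 u) := by
  -- `F` is a complement of the generalized eigenspace of `ν`; outside it the component along `ν` is
  -- nonzero.
  set F : Submodule ℂ E := ⨆ μ, ⨆ (_ : μ ≠ ν), T.maxGenEigenspace μ with hF
  have hdisj : Disjoint (T.maxGenEigenspace ν) F :=
    Module.End.independent_maxGenEigenspace T ν
  have hsup : T.maxGenEigenspace ν ⊔ F = ⊤ := by
    rw [eq_top_iff, ← Module.End.iSup_maxGenEigenspace_eq_top T]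
    refine iSup_le fun μ => ?_
    by_cases h : μ = ν
    · exact h ▸ le_sup_left
    · exact le_sup_of_le_right (le_iSup₂_of_le μ h le_rfl)
  have hFdecay : F ≤ decaySubmodule T ν :=
    iSup₂_le fun μ hμ => maxGenEigenspace_le_decaySubmodule_of_hasEigenvalue fun h => hdom μ h hμ
  refine ⟨F, fun htop => ?_, fun x hx => ?_⟩
  · rw [htop, disjoint_top] at hdisj
    obtain ⟨v, hv⟩ := hν.exists_hasEigenvector
    have hmem : v ∈ T.maxGenEigenspace ν := Module.End.eigenspace_le_maxGenEigenspace hv.1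
    rw [hdisj] at hmem
    exact hv.2 (by simpa using hmem)
  · obtain ⟨y, hy, z, hz, rfl⟩ := Submodule.mem_sup.1 (hsup ▸ Submodule.mem_top : x ∈ _ ⊔ F)
    have hy0 : y ≠ 0 := by
      rintro rfl
      exact hx (by simpa using hz)
    obtain ⟨m, u, hu0, hu, hlim⟩ := exists_tendsto_of_mem_maxGenEigenspace hν0 hy hy0
    refine ⟨m, u, hu0, hu, ?_⟩
    have hz' := mem_decaySubmodule.1 (hFdecay hz)
    have hinv : Tendsto (fun n : ℕ => ((n : ℝ)⁻¹) ^ m) atTop (𝓝 (0 ^ m)) :=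
      (tendsto_inv_atTop_nhds_zero_nat (𝕜 := ℝ)).pow m
    have := hlim.add (hinv.smul hz')
    simp only [smul_zero, add_zero] at this
    refine this.congr fun n => ?_
    rw [map_add, smul_add, smul_add]

end Dominance

/-! ### Perron–Frobenius for nonnegative matrices, and the trace -/

section Perron

variable {n : Type*} [Fintype n]

theorem map_ofReal_mulVec (A : Matrix n n ℝ) (x : n → ℝ) :
    (A.map Complex.ofReal).mulVec (fun i => (x i : ℂ)) = fun i => ((A.mulVec x i : ℝ) : ℂ) := by
  ext i
  simp [Matrix.mulVec, dotProduct]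

theorem mulVec_le_mulVec_of_nonneg {A : Matrix n n ℝ} (hA : ∀ i j, 0 ≤ A i j) {x y : n → ℝ}
    (hxy : x ≤ y) : A.mulVec x ≤ A.mulVec y := fun i =>
  Finset.sum_le_sum fun j _ => mul_le_mul_of_nonneg_left (hxy j) (hA i j)

variable [DecidableEq n]

theorem mem_spectrum_iff_exists_mulVec {M : Matrix n n ℂ} {μ : ℂ} :
    μ ∈ spectrum ℂ M ↔ ∃ v : n → ℂ, v ≠ 0 ∧ M.mulVec v = μ • v := by
  rw [← Matrix.spectrum_toLin', ← Module.End.hasEigenvalue_iff_mem_spectrum]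
  constructor
  · intro h
    obtain ⟨v, hv⟩ := h.exists_hasEigenvector
    exact ⟨v, hv.2, by simpa using hv.apply_eq_smul⟩
  · rintro ⟨v, hv0, hv⟩
    exact Module.End.hasEigenvalue_of_hasEigenvector
      ⟨Module.End.mem_eigenspace_iff.2 (by simpa using hv), hv0⟩

theorem ofReal_mem_spectrum_map {A : Matrix n n ℝ} {t : ℝ}
    (h : (Matrix.scalar n t - A).det = 0) : (t : ℂ) ∈ spectrum ℂ (A.map Complex.ofReal) := by
  obtain ⟨v, hv0, hv⟩ := Matrix.exists_mulVec_eq_zero_iff.2 h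
  refine mem_spectrum_iff_exists_mulVec.2 ⟨fun i => (v i : ℂ), fun h0 => hv0 ?_, ?_⟩
  · ext i
    have := congrFun h0 i
    simpa using this
  · rw [map_ofReal_mulVec]
    ext i
    have := congrFun hv i
    simp only [Matrix.sub_mulVec, Pi.sub_apply, Pi.zero_apply, Matrix.scalar_apply,
      Matrix.mulVec_diagonal, sub_eq_zero] at this
    simp [← this]

/-- The resolvent of a nonnegative matrix is positive to the right of the spectral radius. -/
theorem nonneg_of_mulVec_le_smul {A : Matrix n n ℝ} (hA : ∀ i j, 0 ≤ A i j) {t : ℝ} (ht : 0 < t)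
    (hspec : ∀ μ ∈ spectrum ℂ (A.map Complex.ofReal), ‖μ‖ < t) {d : n → ℝ}
    (hd : A.mulVec d ≤ t • d) : 0 ≤ d := by
  set T : Module.End ℂ (n → ℂ) := Matrix.toLin' (A.map Complex.ofReal) with hT
  -- Iterating `A d ≤ t d` gives `t⁻ᵏ Aᵏ d ≤ d`, and the left side tends to `0`.
  have hdec : (fun i => (d i : ℂ)) ∈ decaySubmodule T (t : ℂ) := by
    rw [decaySubmodule_eq_top]
    · trivial
    · intro μ hμ
      rw [Module.End.hasEigenvalue_iff_mem_spectrum, hT, Matrix.spectrum_toLin'] at hμ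
      simpa [abs_of_pos ht] using hspec μ hμ
  have hpow : ∀ k : ℕ, (T ^ k) (fun i => (d i : ℂ)) =
      fun i => (((A ^ k).mulVec d i : ℝ) : ℂ) := by
    intro k
    induction k with
    | zero => simp
    | succ k ih =>
      rw [pow_succ', Module.End.mul_apply, ih, hT, Matrix.toLin'_apply, map_ofReal_mulVec,
        Matrix.mulVec_mulVec, ← pow_succ']
  have hle : ∀ k : ℕ, (A ^ k).mulVec d ≤ t ^ k • d := by
    intro k
    induction k with
    | zero => simp
    | succ k ih =>
      rw [pow_succ', ← Matrix.mulVec_mulVec]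
      refine (mulVec_le_mulVec_of_nonneg hA ih).trans ?_
      rw [Matrix.mulVec_smul, pow_succ, mul_smul]
      exact smul_le_smul_of_nonneg_left hd (by positivity)
  intro i
  have hlim := (Complex.continuous_re.tendsto _).comp
    ((tendsto_pi_nhds.1 (mem_decaySubmodule.1 hdec)) i)
  refine le_of_tendsto hlim (Eventually.of_forall fun k => ?_)
  have hki := hle k i
  simp only [Function.comp_apply, hpow, Pi.smul_apply, smul_eq_mul] at hki ⊢
  rw [← Complex.ofReal_inv, ← Complex.ofReal_pow, ← Complex.ofReal_mul, Complex.ofReal_re,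
    inv_pow, inv_mul_le_iff₀ (by positivity)]
  exact hki

/-- The spectral radius of a nonnegative matrix is an eigenvalue. -/
theorem exists_mem_spectrum_norm_le_re [Nonempty n] {A : Matrix n n ℝ} (hA : ∀ i j, 0 ≤ A i j) :
    ∃ r : ℝ, (r : ℂ) ∈ spectrum ℂ (A.map Complex.ofReal) ∧
      ∀ μ ∈ spectrum ℂ (A.map Complex.ofReal), ‖μ‖ ≤ r := by
  obtain ⟨μ₀, hμ₀, hmax⟩ := Set.exists_max_image (spectrum ℂ (A.map Complex.ofReal))
    (fun μ => ‖μ‖) (Matrix.finite_spectrum _)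
    (spectrum.nonempty_of_isAlgClosed_of_finiteDimensional ℂ _)
  refine ⟨‖μ₀‖, ?_, hmax⟩
  set ρ : ℝ := ‖μ₀‖ with hρ
  by_contra hnot
  obtain ⟨v, hv0, hv⟩ := mem_spectrum_iff_exists_mulVec.1 hμ₀
  -- The triangle inequality gives `ρ p ≤ A p`, which forces the resolvent `q t = (t - A)⁻¹ p` to
  -- satisfy `p ≤ (t - ρ) q t` for `t > ρ`. If `ρ` were not an eigenvalue, `q` would be continuous
  -- at `ρ`, and `t ↓ ρ` would give `p ≤ 0`.
  set p : n → ℝ := fun i => ‖v i‖ with hp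
  have hAp : ρ • p ≤ A.mulVec p := by
    intro i
    have hvi := congrFun hv i
    simp only [Pi.smul_apply, smul_eq_mul] at hvi ⊢
    rw [hρ, hp, ← norm_mul, ← hvi]
    refine (norm_sum_le _ _).trans (Finset.sum_le_sum fun j _ => ?_)
    simp [abs_of_nonneg (hA i j)]
  have hdet : ∀ t : ℝ, (t : ℂ) ∉ spectrum ℂ (A.map Complex.ofReal) →
      (Matrix.scalar n t - A).det ≠ 0 := fun t ht h0 => ht (ofReal_mem_spectrum_map h0)
  set q : ℝ → n → ℝ := fun t =>
    ((Matrix.scalar n t - A).det)⁻¹ • (Matrix.scalar n t - A).adjugate.mulVec p with hq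
  have hsolve : ∀ t : ℝ, (t : ℂ) ∉ spectrum ℂ (A.map Complex.ofReal) →
      t • q t - A.mulVec (q t) = p := by
    intro t ht
    have h1 : (Matrix.scalar n t - A).mulVec (q t) = p := by
      rw [hq]
      simp only
      rw [Matrix.mulVec_smul, Matrix.mulVec_mulVec, Matrix.mul_adjugate, Matrix.smul_mulVec,
        Matrix.one_mulVec, inv_smul_smul₀ (hdet t ht)]
    rw [← h1, Matrix.sub_mulVec]
    congr 1
    ext i
    simp [Matrix.mulVec_diagonal]
  have hge : ∀ t : ℝ, ρ < t → p ≤ (t - ρ) • q t := by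
    intro t ht
    have ht0 : 0 < t := (norm_nonneg _).trans_lt ht
    have htn : (t : ℂ) ∉ spectrum ℂ (A.map Complex.ofReal) := by
      intro hmem
      have := hmax _ hmem
      simp only [Complex.norm_real, Real.norm_eq_abs, abs_of_pos ht0] at this
      exact absurd this (not_le.2 ht)
    have hs := hsolve t htn
    rw [← sub_nonneg]
    -- For `d = (t - ρ) q t - p`, the inequality `A d ≤ t d` reduces to `ρ p ≤ A p`.
    refine nonneg_of_mulVec_le_smul hA ht0 (fun μ hμ => (hmax μ hμ).trans_lt ht) ?_
    rw [Matrix.mulVec_sub, Matrix.mulVec_smul]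
    intro i
    have hi := congrFun hs i
    have hAi := hAp i
    simp only [Pi.sub_apply, Pi.smul_apply, smul_eq_mul] at hi hAi ⊢
    have : A.mulVec (q t) i = t * q t i - p i := by linarith
    rw [this]
    linarith
  have hcont : ContinuousAt (fun t : ℝ => (t - ρ) • q t) ρ := by
    have hm : Continuous fun t : ℝ => Matrix.scalar n t - A := by
      change Continuous fun t : ℝ => Matrix.diagonal (fun _ : n => t) - A
      fun_prop
    have hs : ContinuousAt (fun t : ℝ => t - ρ) ρ := by fun_prop
    have h1 : ContinuousAt (fun t : ℝ => ((Matrix.scalar n t - A).det)⁻¹) ρ :=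
      hm.matrix_det.continuousAt.inv₀ (hdet ρ hnot)
    have h2 : ContinuousAt (fun t : ℝ => (Matrix.scalar n t - A).adjugate.mulVec p) ρ :=
      (hm.matrix_adjugate.matrix_mulVec continuous_const).continuousAt
    exact hs.smul (h1.smul h2)
  have hlim : Tendsto (fun t : ℝ => (t - ρ) • q t) (𝓝[>] ρ) (𝓝 0) := by
    have := hcont.tendsto
    simp only [sub_self, zero_smul] at this
    exact this.mono_left nhdsWithin_le_nhds
  refine hv0 (funext fun i => ?_)
  have hpi : p i ≤ 0 := ge_of_tendsto (tendsto_pi_nhds.1 hlim i)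
    (eventually_nhdsWithin_of_forall fun t ht => hge t ht i)
  exact norm_le_zero_iff.1 hpi

theorem conj_mem_spectrum_map {A : Matrix n n ℝ} {μ : ℂ}
    (h : μ ∈ spectrum ℂ (A.map Complex.ofReal)) :
    (starRingEnd ℂ) μ ∈ spectrum ℂ (A.map Complex.ofReal) := by
  obtain ⟨v, hv0, hv⟩ := mem_spectrum_iff_exists_mulVec.1 h
  refine mem_spectrum_iff_exists_mulVec.2 ⟨fun i => (starRingEnd ℂ) (v i), fun h0 => hv0 ?_, ?_⟩
  · ext i
    have := congrFun h0 i
    simpa using this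
  · ext i
    have := congrArg (starRingEnd ℂ) (congrFun hv i)
    simpa [Matrix.mulVec, dotProduct] using this

/-- The eigenvalues, with multiplicity, sum to the trace, so their real parts cannot all be
positive. This serves graphs without self-loops. -/
theorem re_nonpos_of_trace_eq_zero [Nonempty n] {M : Matrix n n ℂ} (hM : M.trace = 0) {l : ℂ}
    (hl : ∀ μ ∈ spectrum ℂ M, l.re ≤ μ.re) : l.re ≤ 0 := by
  by_contra! hpos
  have hroots : ∀ μ ∈ M.charpoly.roots, μ ∈ spectrum ℂ M := fun μ hμ =>
    Matrix.mem_spectrum_iff_isRoot_charpoly.2 ((Polynomial.mem_roots'.1 hμ).2)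
  have hsum : (M.charpoly.roots.map Complex.re).sum = 0 := by
    have h1 : (M.charpoly.roots.map Complex.reAddGroupHom).sum =
        Complex.reAddGroupHom M.charpoly.roots.sum := (map_multiset_sum _ _).symm
    rw [← Matrix.trace_eq_sum_roots_charpoly, hM] at h1
    simpa using h1
  have hcard : M.charpoly.roots.card = Fintype.card n := by
    rw [← Matrix.charpoly_natDegree_eq_dim M]
    exact (IsAlgClosed.splits M.charpoly).natDegree_eq_card_roots.symm
  have hle : Multiset.card (M.charpoly.roots.map Complex.re) • l.re ≤
      (M.charpoly.roots.map Complex.re).sum := by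
    refine Multiset.card_nsmul_le_sum fun x hx => ?_
    obtain ⟨μ, hμ, rfl⟩ := Multiset.mem_map.1 hx
    exact hl μ (hroots μ hμ)
  rw [hsum, Multiset.card_map, hcard, nsmul_eq_mul] at hle
  have : (0 : ℝ) < Fintype.card n := by exact_mod_cast Fintype.card_pos
  exact absurd hle (not_le.2 (mul_pos this hpos))

end Perron

/-! ### Dirichlet energy of eigenvectors -/

section Energy

variable {V : Type*} {K : ℕ} {G : Digraph V}

theorem adjacency_nonneg (i j : V) : 0 ≤ adjacency G i j := by
  simp only [adjacency, Matrix.of_apply]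
  split_ifs <;> norm_num

variable [Fintype V]

theorem frobenius_sq (x : Matrix V (Fin K) ℂ) : frobenius x ^ 2 = ∑ i, ∑ k, ‖x i k‖ ^ 2 :=
  Real.sq_sqrt (Finset.sum_nonneg fun _ _ => Finset.sum_nonneg fun _ _ => sq_nonneg _)

theorem frobenius_ne_zero {x : Matrix V (Fin K) ℂ} (hx : x ≠ 0) : frobenius x ≠ 0 := by
  intro h0
  have h := frobenius_sq x
  rw [h0, zero_pow two_ne_zero, eq_comm, Finset.sum_eq_zero_iff_of_nonneg
    fun _ _ => Finset.sum_nonneg fun _ _ => sq_nonneg _] at h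
  refine hx (Matrix.ext fun i k => ?_)
  have hi := (Finset.sum_eq_zero_iff_of_nonneg fun _ _ => sq_nonneg _).1 (h i (Finset.mem_univ i))
    k (Finset.mem_univ k)
  simpa using hi

theorem frobenius_smul {c : ℝ} (hc : 0 ≤ c) (x : Matrix V (Fin K) ℂ) :
    frobenius (c • x) = c * frobenius x := by
  have : ∑ i, ∑ k, ‖(c • x) i k‖ ^ 2 = c ^ 2 * ∑ i, ∑ k, ‖x i k‖ ^ 2 := by
    simp only [Matrix.smul_apply, norm_smul, mul_pow, Finset.mul_sum, Real.norm_eq_abs, sq_abs]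
  rw [frobenius, this, Real.sqrt_mul (sq_nonneg c), Real.sqrt_sq hc, frobenius]

theorem normalized_smul {c : ℝ} (hc : 0 < c) (x : Matrix V (Fin K) ℂ) :
    normalized (c • x) = normalized x := by
  rw [normalized, frobenius_smul hc.le, smul_smul, mul_inv, mul_right_comm, inv_mul_cancel₀ hc.ne',
    one_mul, normalized]

theorem continuous_frobenius : Continuous (frobenius : Matrix V (Fin K) ℂ → ℝ) := by
  unfold frobenius
  fun_prop

theorem continuous_dirichletEnergy :
    Continuous (dirichletEnergy G : Matrix V (Fin K) ℂ → ℝ) := by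
  unfold dirichletEnergy
  fun_prop

theorem inDegree_nonneg (i : V) : 0 ≤ inDegree G i :=
  Finset.sum_nonneg fun j _ => adjacency_nonneg i j

theorem outDegree_nonneg (j : V) : 0 ≤ outDegree G j :=
  Finset.sum_nonneg fun i _ => adjacency_nonneg i j

theorem inDegree_pos_of_adj {u v : V} (h : G.Adj u v) : 0 < inDegree G v :=
  (by simp [adjacency, h] : 0 < adjacency G v u).trans_le
    (Finset.single_le_sum (fun j _ => adjacency_nonneg v j) (Finset.mem_univ u))

theorem outDegree_pos_of_adj {u v : V} (h : G.Adj u v) : 0 < outDegree G u :=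
  (by simp [adjacency, h] : 0 < adjacency G v u).trans_le
    (Finset.single_le_sum (f := fun i => adjacency G i u) (fun i _ => adjacency_nonneg i u)
      (Finset.mem_univ v))

theorem dirichletEnergy_nonneg (x : Matrix V (Fin K) ℂ) : 0 ≤ dirichletEnergy G x :=
  mul_nonneg (by norm_num) (Finset.sum_nonneg fun i _ => Finset.sum_nonneg fun j _ =>
    mul_nonneg (adjacency_nonneg i j) (Finset.sum_nonneg fun _ _ => sq_nonneg _))

variable [DecidableEq V]

theorem sna_apply (i j : V) :
    sna G i j = (√(inDegree G i))⁻¹ * adjacency G i j * (√(outDegree G j))⁻¹ := by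
  simp [sna, Matrix.diagonal_mul, Matrix.mul_diagonal]

theorem sna_nonneg (i j : V) : 0 ≤ sna G i j := by
  rw [sna_apply]
  have := adjacency_nonneg (G := G) i j
  positivity

/-- A strongly connected graph that has an edge has no vertex of zero in- or out-degree. -/
theorem StronglyConnected.degree_pos (hG : StronglyConnected G) (hL : snaC G ≠ 0) (v : V) :
    0 < inDegree G v ∧ 0 < outDegree G v := by
  obtain ⟨a, b, hab⟩ : ∃ a b, G.Adj a b := by
    by_contra! hno
    refine hL (Matrix.ext fun i j => ?_)
    simp [snaC, sna_apply, adjacency, hno]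
  constructor
  · rcases (hG a v).cases_tail with h | ⟨c, -, hc⟩
    · subst h
      rcases (hG b v).cases_tail with h | ⟨c, -, hc⟩
      · subst h
        exact inDegree_pos_of_adj hab
      · exact inDegree_pos_of_adj hc
    · exact inDegree_pos_of_adj hc
  · rcases (hG v b).cases_head with h | ⟨c, hc, -⟩
    · subst h
      rcases (hG v a).cases_head with h | ⟨c, hc, -⟩
      · subst h
        exact outDegree_pos_of_adj hab
      · exact outDegree_pos_of_adj hc
    · exact outDegree_pos_of_adj hc

/-- Expanding the square, the row sums and the column sums of `A` cancel the degrees, so each square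
term contributes `‖y‖²`; the cross term is `-2 Re ⟨y, L y⟩ = -2 l ‖y‖²`. -/
theorem sum_adjacency_mul_norm_sub_sq (hdeg : ∀ v, 0 < inDegree G v ∧ 0 < outDegree G v) {l : ℝ}
    {y : V → ℂ} (hy : (snaC G).mulVec y = (l : ℂ) • y) :
    ∑ i, ∑ j, adjacency G i j * ‖y i / (√(inDegree G i) : ℂ) - y j / (√(outDegree G j) : ℂ)‖ ^ 2 =
      2 * (1 - l) * ∑ i, ‖y i‖ ^ 2 := by
  have hterm : ∀ i j,
      adjacency G i j * ‖y i / (√(inDegree G i) : ℂ) - y j / (√(outDegree G j) : ℂ)‖ ^ 2 =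
      adjacency G i j * (‖y i‖ ^ 2 / inDegree G i) + adjacency G i j * (‖y j‖ ^ 2 / outDegree G j)
        - 2 * (y i * (starRingEnd ℂ) ((sna G i j : ℂ) * y j)).re := by
    intro i j
    have hi : √(inDegree G i) ^ 2 = inDegree G i := Real.sq_sqrt (inDegree_nonneg i)
    have hj : √(outDegree G j) ^ 2 = outDegree G j := Real.sq_sqrt (outDegree_nonneg j)
    have hcross : y i / (√(inDegree G i) : ℂ) * (starRingEnd ℂ) (y j / (√(outDegree G j) : ℂ)) =
        (((√(inDegree G i))⁻¹ * (√(outDegree G j))⁻¹ : ℝ) : ℂ) *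
          (y i * (starRingEnd ℂ) (y j)) := by
      simp only [map_div₀, Complex.conj_ofReal]
      push_cast
      ring
    have hcross' : y i * (starRingEnd ℂ) ((sna G i j : ℂ) * y j) =
        (sna G i j : ℂ) * (y i * (starRingEnd ℂ) (y j)) := by
      simp only [map_mul, Complex.conj_ofReal]
      ring
    rw [Complex.sq_norm, Complex.normSq_sub, ← Complex.sq_norm, ← Complex.sq_norm, norm_div,
      norm_div, div_pow, div_pow, Complex.norm_real, Complex.norm_real, Real.norm_eq_abs,
      Real.norm_eq_abs, sq_abs, sq_abs, hi, hj, hcross, hcross', Complex.re_ofReal_mul,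
      Complex.re_ofReal_mul, sna_apply]
    ring
  have h1 : ∑ i, ∑ j, adjacency G i j * (‖y i‖ ^ 2 / inDegree G i) = ∑ i, ‖y i‖ ^ 2 := by
    refine Finset.sum_congr rfl fun i _ => ?_
    rw [← Finset.sum_mul]
    exact mul_div_cancel₀ _ (hdeg i).1.ne'
  have h2 : ∑ i, ∑ j, adjacency G i j * (‖y j‖ ^ 2 / outDegree G j) = ∑ i, ‖y i‖ ^ 2 := by
    rw [Finset.sum_comm]
    refine Finset.sum_congr rfl fun j _ => ?_
    rw [← Finset.sum_mul]
    exact mul_div_cancel₀ _ (hdeg j).2.ne'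
  have h3 : ∑ i, ∑ j, 2 * (y i * (starRingEnd ℂ) ((sna G i j : ℂ) * y j)).re =
      2 * l * ∑ i, ‖y i‖ ^ 2 := by
    rw [Finset.mul_sum]
    refine Finset.sum_congr rfl fun i _ => ?_
    have hyi : ∑ j, (sna G i j : ℂ) * y j = l * y i := congrFun hy i
    rw [← Finset.mul_sum, ← Complex.re_sum, ← Finset.mul_sum, ← map_sum, hyi, map_mul,
      Complex.conj_ofReal, mul_left_comm, Complex.mul_conj, Complex.re_ofReal_mul,
      Complex.ofReal_re, Complex.sq_norm]
    ring
  simp only [hterm, Finset.sum_add_distrib, Finset.sum_sub_distrib, h1, h2, h3]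
  ring

/-- The energy of a feature matrix whose columns are eigenvectors of the normalized adjacency. -/
theorem dirichletEnergy_of_mul_eq_smul (hdeg : ∀ v, 0 < inDegree G v ∧ 0 < outDegree G v) {l : ℝ}
    {x : Matrix V (Fin K) ℂ}
    (hx : ∀ k, (snaC G).mulVec (fun i => x i k) = (l : ℂ) • fun i => x i k) :
    dirichletEnergy G x = (1 - l) / 2 * frobenius x ^ 2 := by
  have h1 : ∑ i, ∑ j, adjacency G i j * ∑ k,
      ‖x i k / (√(inDegree G i) : ℂ) - x j k / (√(outDegree G j) : ℂ)‖ ^ 2 =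
      ∑ k, ∑ i, ∑ j, adjacency G i j *
        ‖x i k / (√(inDegree G i) : ℂ) - x j k / (√(outDegree G j) : ℂ)‖ ^ 2 := by
    simp only [Finset.mul_sum]
    rw [Finset.sum_comm (s := Finset.univ (α := Fin K))]
    exact Finset.sum_congr rfl fun i _ => Finset.sum_comm
  rw [dirichletEnergy, h1, Finset.sum_congr rfl fun k _ =>
    sum_adjacency_mul_norm_sub_sq hdeg (hx k), ← Finset.mul_sum, frobenius_sq,
    Finset.sum_comm (s := Finset.univ (α := Fin K))]
  ring

/-- Normalization ignores the positive factors `c n`, so by continuity the energies converge to that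
of `normalized u`. -/
theorem isFrequencyDominant_of_tendsto (hdeg : ∀ v, 0 < inDegree G v ∧ 0 < outDegree G v) {l : ℝ}
    {x : ℕ → Matrix V (Fin K) ℂ} {c : ℕ → ℝ} {u : Matrix V (Fin K) ℂ} (hu0 : u ≠ 0)
    (hu : ∀ k, (snaC G).mulVec (fun i => u i k) = (l : ℂ) • fun i => u i k)
    (hc : ∀ᶠ n in atTop, 0 < c n) (hlim : Tendsto (fun n => c n • x n) atTop (𝓝 u)) :
    IsFrequencyDominant G x (1 - l) := by
  have hf := frobenius_ne_zero hu0
  have hnorm : Tendsto (fun n => normalized (c n • x n)) atTop (𝓝 (normalized u)) :=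
    (((continuous_frobenius.tendsto u).comp hlim).inv₀ hf).smul hlim
  have hval : dirichletEnergy G (normalized u) = (1 - l) / 2 := by
    have h1 : frobenius (normalized u) = 1 := by
      have hpos : 0 ≤ frobenius u := Real.sqrt_nonneg _
      rw [normalized, frobenius_smul (inv_nonneg.2 hpos), inv_mul_cancel₀ hf]
    rw [dirichletEnergy_of_mul_eq_smul hdeg (l := l), h1]
    · ring
    · intro k
      have : (fun i => normalized u i k) = (frobenius u)⁻¹ • fun i => u i k := rfl
      rw [this, Matrix.mulVec_smul, hu k, smul_comm]
  have hE : Tendsto (fun n => dirichletEnergy G (normalized (x n))) atTop (𝓝 ((1 - l) / 2)) := by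
    rw [← hval]
    refine ((continuous_dirichletEnergy.tendsto _).comp hnorm).congr' ?_
    filter_upwards [hc] with n hn
    simp [normalized_smul hn]
  refine ⟨?_, hE⟩
  -- The bound `l ≤ 1` comes for free: `(1 - l) / 2` is a limit of nonnegative energies.
  have := ge_of_tendsto' hE fun n => dirichletEnergy_nonneg (G := G) (normalized (x n))
  linarith

end Energy

/-! ### Spectrum and generic orbits of the Euler step -/

section Euler

variable {V : Type*} [Fintype V] [DecidableEq V] {K : ℕ} {G : Digraph V}

/-- One explicit Euler step for the heat equation with diagonal channel weights `w`. -/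
def eulerStep (G : Digraph V) (w : Fin K → ℝ) (h : ℝ) : Module.End ℂ (V → Fin K → ℂ) where
  toFun x := fun i k => x i k - ((h * w k : ℝ) : ℂ) * (snaC G).mulVec (fun j => x j k) i
  map_add' x y := by
    ext i k
    simp only [Matrix.mulVec, dotProduct, Pi.add_apply, mul_add, Finset.sum_add_distrib]
    ring
  map_smul' c x := by
    ext i k
    simp only [Matrix.mulVec, dotProduct, Pi.smul_apply, smul_eq_mul, RingHom.id_apply,
      mul_left_comm _ c, ← Finset.mul_sum, mul_sub]

theorem eulerStep_apply (w : Fin K → ℝ) (h : ℝ) (x : V → Fin K → ℂ) (i : V) (k : Fin K) :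
    eulerStep G w h x i k =
      x i k - ((h * w k : ℝ) : ℂ) * (snaC G).mulVec (fun j => x j k) i := rfl

theorem eulerScheme_heatField_diagonal (w : Fin K → ℝ) (h : ℝ) (x : V → Fin K → ℂ) (n : ℕ) :
    eulerScheme (heatField G (Matrix.diagonal w)) h (Matrix.of x) n =
      Matrix.of ((eulerStep G w h ^ n) x) := by
  induction n with
  | zero => simp [eulerScheme]
  | succ n ih =>
    rw [eulerScheme, ih, pow_succ', Module.End.mul_apply]
    ext i k
    rw [Matrix.of_apply, eulerStep_apply, heatField, Matrix.diagonal_map (by simp),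
      Matrix.add_apply, Matrix.smul_apply, Matrix.neg_apply, Matrix.mul_diagonal, Matrix.of_apply,
      Complex.real_smul, Matrix.mul_apply]
    simp only [Matrix.of_apply, Matrix.mulVec, dotProduct]
    push_cast
    ring

/-- On every nonzero column, an eigenvector of the Euler step gives an eigenvalue of the
normalized adjacency. -/
theorem exists_mem_spectrum_of_eulerStep_eq {w : Fin K → ℝ} {h : ℝ} (hh : h ≠ 0)
    (hne : (spectrum ℂ (snaC G)).Nonempty) {x : V → Fin K → ℂ} {κ : ℂ}
    (hx : eulerStep G w h x = κ • x) {k : Fin K} (hk : (fun i => x i k) ≠ 0) :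
    ∃ μ ∈ spectrum ℂ (snaC G), κ = 1 - ((h * w k : ℝ) : ℂ) * μ ∧
      (w k ≠ 0 → (snaC G).mulVec (fun i => x i k) = μ • fun i => x i k) := by
  have hcol : ∀ i, ((h * w k : ℝ) : ℂ) * (snaC G).mulVec (fun j => x j k) i =
      (1 - κ) * x i k := by
    intro i
    have := congrFun (congrFun hx i) k
    rw [eulerStep_apply] at this
    simp only [Pi.smul_apply, smul_eq_mul] at this
    linear_combination -this
  by_cases hw : w k = 0
  -- A channel of weight zero never moves: `κ = 1`, any `μ` will do, and the column need not be an
  -- eigenvector.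
  · obtain ⟨μ, hμ⟩ := hne
    refine ⟨μ, hμ, ?_, fun h0 => absurd hw h0⟩
    obtain ⟨i, hi⟩ := Function.ne_iff.1 hk
    have := hcol i
    simp only [hw, mul_zero, Complex.ofReal_zero, zero_mul] at this ⊢
    rcases mul_eq_zero.1 this.symm with h1 | h1
    · linear_combination -h1
    · exact absurd h1 hi
  · have hc : ((h * w k : ℝ) : ℂ) ≠ 0 := by exact_mod_cast mul_ne_zero hh hw
    have hmul : (snaC G).mulVec (fun i => x i k) =
        ((1 - κ) / ((h * w k : ℝ) : ℂ)) • fun i => x i k := by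
      ext i
      rw [Pi.smul_apply, smul_eq_mul, div_mul_eq_mul_div, eq_div_iff hc, ← hcol i, mul_comm]
    refine ⟨_, mem_spectrum_iff_exists_mulVec.2 ⟨_, hk, hmul⟩, ?_, fun _ => hmul⟩
    rw [mul_div_cancel₀ _ hc]
    ring

/-- The difference of squares `(1 - t c)² - ‖1 - t a‖²` is `2 t (Re a - c) - t² (‖a‖² - c²)`, whose
linear term wins for small `t`. -/
theorem eventually_norm_one_sub_lt {a : ℂ} {c : ℝ} (h : c < a.re) :
    ∀ᶠ t : ℝ in 𝓝[>] 0, ‖1 - (t : ℂ) * a‖ < 1 - t * c := by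
  have h1 : ∀ᶠ t : ℝ in 𝓝 0, 0 < 1 - t * c := by
    have : ContinuousAt (fun t : ℝ => 1 - t * c) 0 := by fun_prop
    exact this.eventually_const_lt (by simp)
  have h2 : ∀ᶠ t : ℝ in 𝓝 0, t * (‖a‖ ^ 2 - c ^ 2) < 2 * (a.re - c) := by
    have : ContinuousAt (fun t : ℝ => t * (‖a‖ ^ 2 - c ^ 2)) 0 := by fun_prop
    exact this.eventually_lt_const (by simpa using h)
  filter_upwards [nhdsWithin_le_nhds h1, nhdsWithin_le_nhds h2, self_mem_nhdsWithin]
    with t ht1 ht2 ht0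
  have ht0' : (0 : ℝ) < t := ht0
  refine lt_of_pow_lt_pow_left₀ 2 ht1.le ?_
  have hsq : ‖1 - (t : ℂ) * a‖ ^ 2 = 1 - 2 * t * a.re + t ^ 2 * ‖a‖ ^ 2 := by
    rw [Complex.sq_norm, Complex.sq_norm, Complex.normSq_apply, Complex.normSq_apply]
    simp only [Complex.sub_re, Complex.one_re, Complex.re_ofReal_mul, Complex.sub_im,
      Complex.one_im, Complex.im_ofReal_mul]
    ring
  rw [hsq]
  nlinarith [mul_lt_mul_of_pos_left ht2 ht0']

/-- If the minimum `c` of `w k * re μ` is attained only at the real eigenvalue `l`, then for small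
step size almost every Euler trajectory is `(1 - l)`-frequency-dominant. -/
theorem exists_step_ae_isFrequencyDominant (hG : StronglyConnected G) (hL : snaC G ≠ 0)
    {w : Fin K → ℝ} {l c : ℝ} (hle : ∀ k, ∀ μ ∈ spectrum ℂ (snaC G), c ≤ w k * μ.re)
    (heq : ∀ k, ∀ μ ∈ spectrum ℂ (snaC G), w k * μ.re = c → μ = l ∧ w k ≠ 0)
    (hatt : ∃ k, ∃ μ ∈ spectrum ℂ (snaC G), w k * μ.re = c) :
    ∃ h₀ : ℝ, 0 < h₀ ∧ ∀ h : ℝ, 0 < h → h < h₀ → ∀ᵐ x₀ : V → Fin K → ℂ,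
      IsFrequencyDominant G
        (eulerScheme (heatField G (Matrix.diagonal w)) h (Matrix.of x₀)) (1 - l) := by
  have hfin : (spectrum ℂ (snaC G)).Finite := Matrix.finite_spectrum _
  have hev : ∀ᶠ h : ℝ in 𝓝[>] 0, 0 < 1 - h * c ∧ ∀ k, ∀ μ ∈ spectrum ℂ (snaC G),
      c < w k * μ.re → ‖1 - (h : ℂ) * ((w k : ℂ) * μ)‖ < 1 - h * c := by
    refine Filter.Eventually.and ?_ ?_
    · have : ContinuousAt (fun t : ℝ => 1 - t * c) 0 := by fun_prop
      exact nhdsWithin_le_nhds (this.eventually_const_lt (by simp))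
    · refine eventually_all.2 fun k => (eventually_all_finite hfin).2 fun μ _ => ?_
      by_cases hlt : c < w k * μ.re
      · filter_upwards [eventually_norm_one_sub_lt (a := (w k : ℂ) * μ) (c := c)
          (by rwa [Complex.re_ofReal_mul])] with t ht _ using ht
      · exact Eventually.of_forall fun t ht => absurd ht hlt
  obtain ⟨h₀, hh₀, hsub⟩ := mem_nhdsGT_iff_exists_Ioo_subset.1 hev
  refine ⟨h₀, hh₀, fun h hpos hlt => ?_⟩
  obtain ⟨hν, hnorm⟩ := hsub ⟨hpos, hlt⟩
  set ν : ℝ := 1 - h * c with hνdef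
  have hν0 : (ν : ℂ) ≠ 0 := by exact_mod_cast hν.ne'
  have hνnorm : ‖(ν : ℂ)‖ = ν := by simp [abs_of_pos hν]
  obtain ⟨k₀, μ₀, hμ₀, hc⟩ := hatt
  have hne : (spectrum ℂ (snaC G)).Nonempty := ⟨μ₀, hμ₀⟩
  -- Each candidate eigenvalue is smaller than `ν` in modulus or equal to `ν`, so `ν` strictly
  -- dominates.
  have hdich : ∀ k, ∀ μ ∈ spectrum ℂ (snaC G),
      ‖1 - ((h * w k : ℝ) : ℂ) * μ‖ < ν ∨
        (1 - ((h * w k : ℝ) : ℂ) * μ = ν ∧ μ = l ∧ w k ≠ 0) := by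
    intro k μ hμ
    rcases (hle k μ hμ).lt_or_eq with h1 | h1
    · left
      have := hnorm k μ hμ h1
      rwa [← mul_assoc, ← Complex.ofReal_mul] at this
    · right
      have h2 := heq k μ hμ h1.symm
      refine ⟨?_, h2⟩
      rw [h2.1, Complex.ofReal_re] at h1
      rw [h2.1, hνdef, h1]
      push_cast
      ring
  have hdom : ∀ κ, (eulerStep G w h).HasEigenvalue κ → κ ≠ (ν : ℂ) → ‖κ‖ < ‖(ν : ℂ)‖ := by
    intro κ hκ hκν
    obtain ⟨x, hx⟩ := hκ.exists_hasEigenvector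
    obtain ⟨k, hk⟩ : ∃ k, (fun i => x i k) ≠ 0 := by
      by_contra! hall
      exact hx.2 (funext fun i => funext fun k => congrFun (hall k) i)
    obtain ⟨μ, hμ, hκμ, -⟩ :=
      exists_mem_spectrum_of_eulerStep_eq hpos.ne' hne hx.apply_eq_smul hk
    rw [hνnorm, hκμ]
    rcases hdich k μ hμ with h1 | ⟨h1, -⟩
    · exact h1
    · exact absurd (hκμ.trans h1) hκν
  have heig : (eulerStep G w h).HasEigenvalue (ν : ℂ) := by
    obtain ⟨v, hv0, hv⟩ := mem_spectrum_iff_exists_mulVec.1 hμ₀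
    have hval : 1 - ((h * w k₀ : ℝ) : ℂ) * μ₀ = ν := by
      rw [(heq k₀ μ₀ hμ₀ hc).1, hνdef, ← hc, (heq k₀ μ₀ hμ₀ hc).1, Complex.ofReal_re]
      push_cast
      ring
    refine Module.End.hasEigenvalue_of_hasEigenvector (x := fun i k => if k = k₀ then v i else 0)
      ⟨Module.End.mem_eigenspace_iff.2 ?_, fun h0 => hv0 (funext fun i => ?_)⟩
    · ext i k
      rw [eulerStep_apply, ← hval]
      by_cases hk : k = k₀
      · subst hk
        simp only [if_true, hv, Pi.smul_apply, smul_eq_mul]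
        ring
      · simp [hk, Matrix.mulVec, dotProduct]
    · simpa using congrFun (congrFun h0 i) k₀
  obtain ⟨F, hF, hlim⟩ := exists_submodule_tendsto_of_dominant hν0 heig hdom
  -- Haar measure is taken over `ℝ`, where a proper subspace is null.
  have hF' : F.restrictScalars ℝ ≠ ⊤ := by
    rwa [Ne, Submodule.restrictScalars_eq_top_iff]
  have : (volume : Measure (Fin K → ℂ)).IsAddHaarMeasure := Measure.pi.isAddHaarMeasure _
  have : (volume : Measure (V → Fin K → ℂ)).IsAddHaarMeasure := Measure.pi.isAddHaarMeasure _
  have hnull := Measure.addHaar_submodule (volume : Measure (V → Fin K → ℂ)) _ hF'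
  filter_upwards [measure_eq_zero_iff_ae_notMem.1 hnull] with x₀ hx₀
  obtain ⟨m, u, hu0, hu, htend⟩ := hlim x₀ hx₀
  refine isFrequencyDominant_of_tendsto (hG.degree_pos hL) (c := fun n => ((n : ℝ)⁻¹) ^ m * ν⁻¹ ^ n)
    (u := Matrix.of u) hu0 (fun k => ?_) ?_ ?_
  · by_cases hk : (fun i => u i k) = 0
    · change (snaC G).mulVec (fun i => u i k) = (l : ℂ) • fun i => u i k
      rw [hk]
      simp
    · obtain ⟨μ, hμ, hκμ, hmul⟩ := exists_mem_spectrum_of_eulerStep_eq hpos.ne' hne hu hk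
      rcases hdich k μ hμ with h1 | ⟨-, h1, h2⟩
      · rw [← hκμ, hνnorm] at h1
        exact absurd h1 (lt_irrefl _)
      · exact h1 ▸ hmul h2
  -- At `n = 0` the convention `0⁻¹ = 0` makes the factor vanish when `m > 0`.
  · filter_upwards [eventually_gt_atTop 0] with n hn
    have : (0 : ℝ) < n := by exact_mod_cast hn
    positivity
  · refine htend.congr fun n => ?_
    rw [eulerScheme_heatField_diagonal, mul_smul]
    ext i k
    simp [Matrix.smul_apply]

end Euler

/-! ### Passing from `L` to `I - L` -/

section Spectrum

variable {V : Type*} [Fintype V] [DecidableEq V] {M : Matrix V V ℂ} {l : ℂ}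

theorem mem_spectrum_one_sub_iff {μ : ℂ} : μ ∈ spectrum ℂ (1 - M) ↔ 1 - μ ∈ spectrum ℂ M := by
  simp only [mem_spectrum_iff_exists_mulVec, Matrix.sub_mulVec, Matrix.one_mulVec, sub_smul,
    one_smul]
  refine exists_congr fun v => and_congr_right fun _ => ?_
  rw [sub_eq_iff_eq_add, eq_sub_iff_add_eq, eq_comm, add_comm]

theorem IsLowestEigenvalue.one_sub (h : IsLowestEigenvalue M l) :
    IsHighestEigenvalue (1 - M) (1 - l) := by
  refine ⟨mem_spectrum_one_sub_iff.2 (by simpa using h.1), fun m hm => ?_⟩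
  have := h.2 _ (mem_spectrum_one_sub_iff.1 hm)
  simp only [Complex.sub_re, Complex.one_re] at this ⊢
  linarith

theorem IsHighestEigenvalue.one_sub (h : IsHighestEigenvalue M l) :
    IsLowestEigenvalue (1 - M) (1 - l) := by
  refine ⟨mem_spectrum_one_sub_iff.2 (by simpa using h.1), fun m hm => ?_⟩
  have := h.2 _ (mem_spectrum_one_sub_iff.1 hm)
  simp only [Complex.sub_re, Complex.one_re] at this ⊢
  linarith

end Spectrum

/-! ### Locating the minimum of `w_k Re μ` -/

section Main

variable {V : Type*} [Fintype V] [DecidableEq V] {K : ℕ} {G : Digraph V}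

theorem trace_snaC_eq_zero (hloop : ¬ ∃ v, G.Adj v v) : (snaC G).trace = 0 := by
  push Not at hloop
  simp [Matrix.trace, snaC, sna_apply, adjacency, hloop]

/-- The spectral radius is itself an eigenvalue, hence at most the largest real part. -/
theorem IsHighestEigenvalue.norm_le_re [Nonempty V] {l : ℂ}
    (hl : IsHighestEigenvalue (snaC G) l) : ∀ μ ∈ spectrum ℂ (snaC G), ‖μ‖ ≤ l.re := by
  obtain ⟨r, hr, hle⟩ := exists_mem_spectrum_norm_le_re (A := sna G) sna_nonneg
  exact fun μ hμ => (hle μ hμ).trans (by simpa using hl.2 r hr)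

/-- The conjugate of `l` is an eigenvalue with the same real part, so uniqueness makes `l` real. -/
theorem IsLowestEigenvalue.eq_ofReal_of_unique {l : ℂ} (hl : IsLowestEigenvalue (snaC G) l)
    (huniq : ∀ m ∈ spectrum ℂ (snaC G), m.re = l.re → m = l) : l = (l.re : ℂ) :=
  (Complex.conj_eq_iff_re.1 (huniq _ (conj_mem_spectrum_map hl.1) (Complex.conj_re l))).symm

theorem eq_ofReal_of_norm_le_of_re_eq {μ : ℂ} {r : ℝ} (h : ‖μ‖ ≤ r) (hre : μ.re = r) :
    μ = (r : ℂ) := by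
  rw [← hre] at h ⊢
  have h0 : |μ.re| = ‖μ‖ := le_antisymm (Complex.abs_re_le_norm μ) (h.trans (le_abs_self _))
  exact Complex.ext rfl (Complex.abs_re_eq_norm.1 h0)

/-- For small steps almost every Euler trajectory is highest-frequency-dominant when the lowest
eigenvalue is unique and `λ_K(W) Re λ₁(L) < λ₁(W) Re λ_N(L)`. -/
theorem exists_step_ae_isHFD [Nonempty V] (hG : StronglyConnected G) (hL : snaC G ≠ 0)
    {w : Fin K → ℝ} {k₁ kK : Fin K} (h₁ : ∀ k, w k₁ ≤ w k) (hK : ∀ k, w k ≤ w kK) {l₁ lN : ℂ}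
    (hl₁ : IsLowestEigenvalue (snaC G) l₁) (hlN : IsHighestEigenvalue (snaC G) lN)
    (huniq : ∀ m ∈ spectrum ℂ (snaC G), m.re = l₁.re → m = l₁)
    (hlt : w kK * l₁.re < w k₁ * lN.re) :
    ∃ h₀ : ℝ, 0 < h₀ ∧ ∀ h : ℝ, 0 < h → h < h₀ → ∀ᵐ x₀ : V → Fin K → ℂ,
      IsHFD G (eulerScheme (heatField G (Matrix.diagonal w)) h (Matrix.of x₀)) := by
  have hreal := hl₁.eq_ofReal_of_unique huniq
  have hρ0 : 0 ≤ lN.re := (norm_nonneg _).trans (hlN.norm_le_re lN hlN.1)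
  set a := l₁.re with ha
  set ρ := lN.re with hρ
  have haρ : a ≤ ρ := hl₁.2 lN hlN.1
  have hwK : 0 < w kK := by
    by_contra! hneg
    have h1 : w k₁ * ρ ≤ w kK * ρ := mul_le_mul_of_nonneg_right (h₁ kK) hρ0
    have h2 : w kK * ρ ≤ w kK * a := mul_le_mul_of_nonpos_left haρ hneg
    linarith
  have hw₁ : 0 ≤ a → 0 < w k₁ := by
    intro h0
    by_contra! hneg
    have h1 : w k₁ * ρ ≤ 0 := mul_nonpos_of_nonpos_of_nonneg hneg hρ0
    have h2 : 0 ≤ w kK * a := mul_nonneg hwK.le h0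
    linarith
  -- The minimum of `w k * a` is at `kK` when `a ≤ 0` but at `k₁` when `a ≥ 0`; in the latter case
  -- all weights are positive by `hw₁`.
  obtain ⟨k, hk, hmin⟩ : ∃ k, (k = k₁ ∨ k = kK) ∧
      w k * a ≤ w k₁ * a ∧ w k * a ≤ w kK * a := by
    rcases le_total (w k₁ * a) (w kK * a) with h | h
    · exact ⟨k₁, Or.inl rfl, le_rfl, h⟩
    · exact ⟨kK, Or.inr rfl, h, le_rfl⟩
  have hmain : ∀ j, ∀ μ ∈ spectrum ℂ (snaC G), w k * a ≤ w j * μ.re ∧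
      (w j * μ.re = w k * a → μ = (a : ℂ) ∧ w j ≠ 0) := by
    intro j μ hμ
    have haμ : a ≤ μ.re := hl₁.2 μ hμ
    have hμρ : μ.re ≤ ρ := hlN.2 μ hμ
    -- Only positive weights can attain the minimum: a negative one gives at least `w k₁ * ρ`, which
    -- exceeds `w kK * a`.
    rcases lt_trichotomy (w j) 0 with hj | hj | hj
    · have h1 : w j * ρ ≤ w j * μ.re := mul_le_mul_of_nonpos_left hμρ hj.le
      have h2 : w k₁ * ρ ≤ w j * ρ := mul_le_mul_of_nonneg_right (h₁ j) hρ0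
      have h3 : w k * a < w j * μ.re := by linarith [hmin.2]
      exact ⟨h3.le, fun h => absurd h h3.ne'⟩
    · have ha0 : a < 0 := by
        by_contra! h0
        linarith [hw₁ h0, h₁ j]
      have h3 : w k * a < w j * μ.re := by
        rw [hj, zero_mul]
        linarith [hmin.2, mul_neg_of_pos_of_neg hwK ha0]
      exact ⟨h3.le, fun h => absurd h h3.ne'⟩
    · have h1 : w k * a ≤ w j * a := by
        rcases le_total 0 a with h0 | h0
        · exact hmin.1.trans (mul_le_mul_of_nonneg_right (h₁ j) h0)
        · exact hmin.2.trans (mul_le_mul_of_nonpos_right (hK j) h0)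
      have h2 : w j * a ≤ w j * μ.re := mul_le_mul_of_nonneg_left haμ hj.le
      refine ⟨h1.trans h2, fun h => ⟨?_, hj.ne'⟩⟩
      have h3 : w j * μ.re = w j * a := le_antisymm (h.le.trans h1) h2
      rw [← hreal]
      exact huniq μ hμ (mul_left_cancel₀ hj.ne' h3)
  obtain ⟨h₀, hh₀, hstep⟩ := exists_step_ae_isFrequencyDominant hG hL
    (fun j μ hμ => (hmain j μ hμ).1) (fun j μ hμ => (hmain j μ hμ).2) ⟨k, l₁, hl₁.1, rfl⟩
  refine ⟨h₀, hh₀, fun h hpos hlt' => ?_⟩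
  filter_upwards [hstep h hpos hlt'] with x₀ hx₀
  refine ⟨1 - a, ?_, hx₀⟩
  push_cast
  rw [← hreal]
  exact hl₁.one_sub

/-- For small steps almost every Euler trajectory is lowest-frequency-dominant when
`λ₁(W) Re λ_N(L) < λ_K(W) Re λ₁(L)`, with `λ₁(W) < 0` if there are self-loops. -/
theorem exists_step_ae_isLFD [Nonempty V] (hG : StronglyConnected G) (hL : snaC G ≠ 0)
    {w : Fin K → ℝ} {k₁ kK : Fin K} (h₁ : ∀ k, w k₁ ≤ w k) (hK : ∀ k, w k ≤ w kK) {l₁ lN : ℂ}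
    (hl₁ : IsLowestEigenvalue (snaC G) l₁) (hlN : IsHighestEigenvalue (snaC G) lN)
    (hlt : w k₁ * lN.re < w kK * l₁.re) (hloop : (∃ v, G.Adj v v) → w k₁ < 0) :
    ∃ h₀ : ℝ, 0 < h₀ ∧ ∀ h : ℝ, 0 < h → h < h₀ → ∀ᵐ x₀ : V → Fin K → ℂ,
      IsLFD G (eulerScheme (heatField G (Matrix.diagonal w)) h (Matrix.of x₀)) := by
  have hnorm := hlN.norm_le_re
  have hreal : lN = (lN.re : ℂ) := eq_ofReal_of_norm_le_of_re_eq (hnorm lN hlN.1) rfl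
  have hρ0 : 0 ≤ lN.re := (norm_nonneg _).trans (hnorm lN hlN.1)
  -- Without self-loops `L` has trace zero, so `a ≤ 0`, and nonnegative weights would contradict
  -- `hlt`.
  have hw₁ : w k₁ < 0 := by
    by_cases hl : ∃ v, G.Adj v v
    · exact hloop hl
    · by_contra! h0
      have ha : l₁.re ≤ 0 := re_nonpos_of_trace_eq_zero (trace_snaC_eq_zero hl) hl₁.2
      have h1 : w kK * l₁.re ≤ 0 := mul_nonpos_of_nonneg_of_nonpos (h0.trans (h₁ kK)) ha
      linarith [mul_nonneg h0 hρ0]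
  -- Spectral radius zero would make both sides of `hlt` vanish.
  have hρ : 0 < lN.re := by
    refine hρ0.lt_of_ne fun h0 => ?_
    have h1 : l₁ = 0 := norm_le_zero_iff.1 (h0 ▸ hnorm l₁ hl₁.1)
    simp [h1, ← h0] at hlt
  set a := l₁.re with ha
  set ρ := lN.re with hρdef
  have hneg : w k₁ * ρ < 0 := mul_neg_of_neg_of_pos hw₁ hρ
  have hmain : ∀ j, ∀ μ ∈ spectrum ℂ (snaC G), w k₁ * ρ ≤ w j * μ.re ∧
      (w j * μ.re = w k₁ * ρ → μ = (ρ : ℂ) ∧ w j ≠ 0) := by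
    intro j μ hμ
    have haμ : a ≤ μ.re := hl₁.2 μ hμ
    have hμρ : μ.re ≤ ρ := hlN.2 μ hμ
    rcases lt_or_ge (w j) 0 with hj | hj
    · have h1 : w j * ρ ≤ w j * μ.re := mul_le_mul_of_nonpos_left hμρ hj.le
      have h2 : w k₁ * ρ ≤ w j * ρ := mul_le_mul_of_nonneg_right (h₁ j) hρ0
      refine ⟨h2.trans h1, fun h => ⟨?_, hj.ne⟩⟩
      exact eq_ofReal_of_norm_le_of_re_eq (hnorm μ hμ)
        (mul_left_cancel₀ hj.ne (le_antisymm (h.le.trans h2) h1))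
    · have h1 : w j * a ≤ w j * μ.re := mul_le_mul_of_nonneg_left haμ hj
      have h3 : w k₁ * ρ < w j * μ.re := by
        rcases le_total 0 a with h0 | h0
        · linarith [mul_nonneg hj h0]
        · linarith [mul_le_mul_of_nonpos_right (hK j) h0]
      exact ⟨h3.le, fun h => absurd h h3.ne'⟩
  obtain ⟨h₀, hh₀, hstep⟩ := exists_step_ae_isFrequencyDominant hG hL
    (fun j μ hμ => (hmain j μ hμ).1) (fun j μ hμ => (hmain j μ hμ).2) ⟨k₁, lN, hlN.1, rfl⟩
  refine ⟨h₀, hh₀, fun h hpos hlt' => ?_⟩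
  filter_upwards [hstep h hpos hlt'] with x₀ hx₀
  refine ⟨1 - ρ, ?_, hx₀⟩
  push_cast
  rw [← hreal]
  exact hlN.one_sub

end Main

end GraphHeat

end

theorem mainTheorem8 {V : Type*} [Fintype V] [DecidableEq V] {K : ℕ}
    (G : Digraph V) (hG : GraphHeat.StronglyConnected G)
    (W : Matrix (Fin K) (Fin K) ℝ) (hW : W.IsDiag)
    (w₁ wK : ℝ) (hw₁ : IsLeast (spectrum ℝ W) w₁) (hwK : IsGreatest (spectrum ℝ W) wK)
    (l₁ lN : ℂ) (hl₁ : GraphHeat.IsLowestEigenvalue (GraphHeat.snaC G) l₁)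
    (hlN : GraphHeat.IsHighestEigenvalue (GraphHeat.snaC G) lN) :
    ∃ h₀ : ℝ, 0 < h₀ ∧ ∀ h : ℝ, 0 < h → h < h₀ →
      ∀ᵐ x₀ : V → Fin K → ℂ,
        (((∀ m ∈ spectrum ℂ (GraphHeat.snaC G), m.re = l₁.re → m = l₁) →
            wK * l₁.re < w₁ * lN.re →
            GraphHeat.IsHFD G
              (GraphHeat.eulerScheme (GraphHeat.heatField G W) h (Matrix.of x₀))) ∧
          (w₁ * lN.re < wK * l₁.re →
            ((∃ v, G.Adj v v) → w₁ < 0) →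
            GraphHeat.IsLFD G
              (GraphHeat.eulerScheme (GraphHeat.heatField G W) h (Matrix.of x₀)))) := by
  obtain ⟨w, rfl⟩ : ∃ w, W = Matrix.diagonal w := ⟨_, hW.diagonal_diag.symm⟩
  rw [spectrum_diagonal] at hw₁ hwK
  obtain ⟨⟨k₁, rfl⟩, h₁⟩ := hw₁
  obtain ⟨⟨kK, rfl⟩, hK⟩ := hwK
  replace h₁ : ∀ k, w k₁ ≤ w k := fun k => h₁ ⟨k, rfl⟩
  replace hK : ∀ k, w k ≤ w kK := fun k => hK ⟨k, rfl⟩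
  -- Equality makes both claims vacuous. This covers `L = 0`, where degrees may vanish.
  by_cases hne : w kK * l₁.re = w k₁ * lN.re
  · exact ⟨1, one_pos, fun h _ _ => Eventually.of_forall fun x₀ =>
      ⟨fun _ hlt => absurd hne hlt.ne, fun hlt _ => absurd hne hlt.ne'⟩⟩
  have hL : GraphHeat.snaC G ≠ 0 := by
    intro h0
    have hzero : ∀ μ ∈ spectrum ℂ (GraphHeat.snaC G), μ = 0 := by
      intro μ hμ
      obtain ⟨v, hv0, hv⟩ := GraphHeat.mem_spectrum_iff_exists_mulVec.1 hμ
      rw [h0, Matrix.zero_mulVec] at hv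
      exact (smul_eq_zero.1 hv.symm).resolve_right hv0
    exact hne (by rw [hzero l₁ hl₁.1, hzero lN hlN.1]; simp)
  have : Nonempty V := by
    by_contra hempty
    rw [not_nonempty_iff] at hempty
    exact hL (Subsingleton.elim _ _)
  -- The hypotheses of the two claims exclude each other, so one threshold `h₀` suffices at a time.
  by_cases h1 : (∀ m ∈ spectrum ℂ (GraphHeat.snaC G), m.re = l₁.re → m = l₁) ∧
      w kK * l₁.re < w k₁ * lN.re
  · obtain ⟨h₀, hh₀, hstep⟩ :=
      GraphHeat.exists_step_ae_isHFD hG hL h₁ hK hl₁ hlN h1.1 h1.2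
    refine ⟨h₀, hh₀, fun h hpos hlt => ?_⟩
    filter_upwards [hstep h hpos hlt] with x₀ hx₀
    exact ⟨fun _ _ => hx₀, fun hgt _ => absurd hgt h1.2.not_gt⟩
  by_cases h2 : w k₁ * lN.re < w kK * l₁.re ∧ ((∃ v, G.Adj v v) → w k₁ < 0)
  · obtain ⟨h₀, hh₀, hstep⟩ :=
      GraphHeat.exists_step_ae_isLFD hG hL h₁ hK hl₁ hlN h2.1 h2.2
    refine ⟨h₀, hh₀, fun h hpos hlt => ?_⟩
    filter_upwards [hstep h hpos hlt] with x₀ hx₀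
    exact ⟨fun ha hb => absurd ⟨ha, hb⟩ h1, fun _ _ => hx₀⟩
  exact ⟨1, one_pos, fun h _ _ => Eventually.of_forall fun x₀ =>
    ⟨fun ha hb => absurd ⟨ha, hb⟩ h1, fun ha hb => absurd ⟨ha, hb⟩ h2⟩⟩
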